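/- Call two elements $\alpha, \beta$ of a group $\Gamma$ trace-commensurable if there are non-zero integers $m, n$ such that $\operatorname{tr}(\rho(\alpha^m))^2 = \operatorname{tr}(\rho(\beta^n))^2$ for every homomorphism $\rho : \Gamma \to \mathrm{SL}_2(\mathbb{C})$. Call $\alpha, \beta$ trace twins if they are trace-commensurable but $\alpha^m$ and $\beta^n$ are not conjugate in $\Gamma$ for any non-zero integers $m, n$. Lemma. Let $F$ be a free group (of any rank), let $a, b \in F$ be (possibly equal) elements of a common basis of $F$, and let $j, k$ be any integers. Then the element $w = a^j b^k$ has no trace twins in $F$. That is, for every $x \in F$, if $w$ and $x$ are trace-commensurable, then some non-zero powers of $w$ and $x$ are conjugate in $F$. -/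

import Mathlib

/-- The character of an element `α` of a group `Γ`: the function `ρ ↦ tr (ρ α)` on the set of
linear representations of `Γ` in `SL₂(ℂ)`. -/
noncomputable def character {Γ : Type*} [Group Γ] (α : Γ)
    (ρ : Γ →* Matrix.SpecialLinearGroup (Fin 2) ℂ) : ℂ :=
  Matrix.trace (ρ α : Matrix (Fin 2) (Fin 2) ℂ)

/-- `α` and `β` are trace-commensurable: for some non-zero integers `m`, `n`, the functions
`tr(α ^ m)²` and `tr(β ^ n)²` on `Hom(Γ, SL₂(ℂ))` are equal. -/
def TraceCommensurable {Γ : Type*} [Group Γ] (α β : Γ) : Prop :=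
  ∃ m n : ℤ, m ≠ 0 ∧ n ≠ 0 ∧
    ∀ ρ : Γ →* Matrix.SpecialLinearGroup (Fin 2) ℂ,
      character (α ^ m) ρ ^ 2 = character (β ^ n) ρ ^ 2

/-- Some non-zero powers of `α` and `β` are conjugate in `Γ`. -/
def HaveConjPowers {Γ : Type*} [Group Γ] (α β : Γ) : Prop :=
  ∃ m n : ℤ, m ≠ 0 ∧ n ≠ 0 ∧ IsConj (α ^ m) (β ^ n)

/-- `α` and `β` are trace twins: they are trace-commensurable, but no non-zero powers of them are
conjugate. -/
def TraceTwins {Γ : Type*} [Group Γ] (α β : Γ) : Prop :=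
  TraceCommensurable α β ∧ ¬ HaveConjPowers α β

/-- `a` and `b` are primitive elements of the free group `F`: they are (possibly equal) members of
a common basis of `F`. -/
def PrimitiveElements {F : Type*} [Group F] (a b : F) : Prop :=
  ∃ (S : Set F) (B : FreeGroupBasis S F), (∀ s : S, B s = s) ∧ a ∈ S ∧ b ∈ S

/-!
Let `w = a ^ j * b ^ k` and `y = x ^ n`, and suppose that `w ^ m` and `y` have the same squared
character. Every conjugacy class of a free group is spelled by a cyclically alternating list of
syllables `s ^ e` (`exists_cyclicallyReduced_syllables`), and three explicit families of
representations read off enough of such a spelling of `y` to identify it.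

* Hyperbolic families. Send each generator `s` to a hyperbolic matrix with eigenvalues
  `exp (± K s * τ)`, the fixed points of all generators being distinct. As `τ → ∞`, the image of a
  syllable, rescaled by `exp (-K s * |e| * τ)`, tends to a projection of rank one. The trace of the
  product of these projections is the product of the pairings of cyclic neighbours
  (`trace_prod_vecMulVec_mem`), and it does not vanish because the word has no cancellation. So the
  growth rate `∑ K s * |e|` is determined by the squared character for every positive weight `K`
  (`sum_mul_abs_eq_of_character_sq_eq`). In particular only generators of `w` occur in `y`. This
  settles the case in which `w` is a power of one generator.
* Unipotent families. Suppose now that `a ≠ b` and `j, k ≠ 0`. Sending `a` and `b` to elementary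
  matrices with a large entry `z` makes the trace of an alternating word in `a`, `b` asymptotic to
  the product of its exponents times `z` to the number of its syllables
  (`tendsto_character_unipotentRep`). So `y` has `2 |m|` syllables, and the product of its exponents
  is that of `w ^ m` up to sign.
* Diagonal representations give the exponent sums up to a common sign
  (`abs_sum_eq_of_character_sq_eq`).

Divide each exponent of `a` in `y` by `j` and each exponent of `b` by `k`. The resulting `2 |m|`
numbers have product `± 1`, their absolute values add up to `2 |m|`, and so does their sum up to
sign. By the equality case of the inequality between arithmetic and geometric means they are all
equal to the same sign `ε`, so `y` is conjugate to `(a ^ (ε * j) * b ^ (ε * k)) ^ |m|`, that is, to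
`w ^ m` or its inverse.
-/

open Filter Topology
open Matrix hiding zpow_add zpow_neg zpow_mul

/-! ### Syllable lists -/

section Syllables

variable {ι F : Type*} [Group F]

/-- The element `∏ (B s) ^ e` of `F` spelled by a list of syllables `(s, e)`. -/
def syllableProd (B : FreeGroupBasis ι F) (L : List (ι × ℤ)) : F :=
  (L.map fun p => B p.1 ^ p.2).prod

@[simp] lemma syllableProd_nil (B : FreeGroupBasis ι F) : syllableProd B [] = 1 := rfl

@[simp] lemma syllableProd_cons (B : FreeGroupBasis ι F) (p : ι × ℤ) (L : List (ι × ℤ)) :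
    syllableProd B (p :: L) = B p.1 ^ p.2 * syllableProd B L := by
  simp [syllableProd]

@[simp] lemma syllableProd_append (B : FreeGroupBasis ι F) (L L' : List (ι × ℤ)) :
    syllableProd B (L ++ L') = syllableProd B L * syllableProd B L' := by
  simp [syllableProd]

lemma lift_basis_apply {H : Type*} [Group H] (B : FreeGroupBasis ι F) (f : ι → H) (s : ι) :
    B.lift f (B s) = f s := by
  rw [FreeGroupBasis.lift_apply_apply, FreeGroupBasis.repr_apply_coe, FreeGroup.lift_apply_of]

lemma isConj_mul_comm (g h : F) : IsConj (g * h) (h * g) :=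
  isConj_iff.2 ⟨g⁻¹, by group⟩

lemma exists_syllableProd_eq (B : FreeGroupBasis ι F) (y : F) :
    ∃ L : List (ι × ℤ), syllableProd B L = y := by
  suffices H : ∀ g : FreeGroup ι, ∃ L : List (ι × ℤ), syllableProd B L = B.repr.symm g by
    simpa using H (B.repr y)
  intro g
  induction g using FreeGroup.induction_on with
  | C1 => exact ⟨[], by simp⟩
  | of s => exact ⟨[(s, 1)], by simp; rfl⟩
  | inv_of s _ => exact ⟨[(s, -1)], by simp; rfl⟩
  | mul x y hx hy =>
    obtain ⟨L, hL⟩ := hx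
    obtain ⟨L', hL'⟩ := hy
    exact ⟨L ++ L', by simp [hL, hL']⟩

/-- Every conjugacy class of a free group contains an element spelled by a list of nonzero syllables
in which cyclically adjacent syllables belong to different generators; a list of length one is its
own neighbour and is excepted. A shortest list of syllables for the class has these properties. -/
theorem exists_cyclicallyReduced_syllables (B : FreeGroupBasis ι F) (y : F) :
    ∃ L : List (ι × ℤ), IsConj (syllableProd B L) y ∧ (∀ p ∈ L, p.2 ≠ 0) ∧
      (L.length ≠ 1 → Cycle.Chain (fun p q : ι × ℤ => p.1 ≠ q.1) (L : Cycle (ι × ℤ))) := by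
  classical
  have hex : ∃ n, ∃ L : List (ι × ℤ), L.length = n ∧ IsConj (syllableProd B L) y := by
    obtain ⟨L, hL⟩ := exists_syllableProd_eq B y
    exact ⟨_, L, rfl, hL ▸ IsConj.refl _⟩
  obtain ⟨L, hlen, hL⟩ := Nat.find_spec hex
  have hmin : ∀ L' : List (ι × ℤ), IsConj (syllableProd B L') y → L.length ≤ L'.length :=
    fun L' h' => hlen ▸ Nat.find_min' hex ⟨L', rfl, h'⟩
  refine ⟨L, hL, fun p hp h0 => ?_, fun h1 => ?_⟩
  · obtain ⟨l₁, l₂, rfl⟩ := List.append_of_mem hp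
    have := hmin (l₁ ++ l₂) (by simpa [h0] using hL)
    simp at this
  · rcases L with _ | ⟨p, l⟩
    · exact Cycle.Chain.nil _
    rw [Cycle.chain_coe_cons, List.isChain_iff_forall_rel_of_append_cons_cons]
    intro a b l₁ l₂ h hab
    rcases List.eq_nil_or_concat' l₂ with rfl | ⟨l₂, c, rfl⟩
    · -- the two syllables are the last one and the first one: rotate before merging
      have h2 : (p :: l) ++ [p] = (l₁ ++ [a]) ++ [b] := by simpa using h
      obtain ⟨h3, h4⟩ := List.append_inj' h2 rfl
      obtain rfl : p = b := by simpa using h4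
      rcases l₁ with _ | ⟨q, l₁⟩
      · simp at h3; simp [h3] at h1
      · obtain ⟨rfl, rfl⟩ : p = q ∧ l = l₁ ++ [a] := by simpa using h3
        have := hmin ((p.1, a.2 + p.2) :: l₁) (by
          refine IsConj.trans ?_ hL
          have := isConj_mul_comm (B p.1 ^ a.2) (B p.1 ^ p.2 * syllableProd B l₁)
          simpa [zpow_add, mul_assoc, hab] using this)
        simp at this
    · have h2 : (p :: l) ++ [p] = (l₁ ++ a :: b :: l₂) ++ [c] := by simpa using h
      obtain ⟨h3, -⟩ := List.append_inj' h2 rfl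
      have := hmin (l₁ ++ (a.1, a.2 + b.2) :: l₂) (by
        rw [h3] at hL
        simpa [zpow_add, mul_assoc, hab] using hL)
      rw [h3] at this
      simp at this

/-- An alternating list in two letters that has even length and does not start with `b`. -/
lemma eq_flatten_replicate_of_isChain_ne {a b : ι} :
    ∀ (m : ℕ) (l : List ι), l.IsChain (· ≠ ·) → (∀ s ∈ l, s = a ∨ s = b) → l.length = 2 * m →
      l.head? ≠ some b → l = (List.replicate m [a, b]).flatten
  | 0, l, _, _, hl, _ => by simpa using hl
  | m + 1, [], _, _, hl, _ => by simp at hl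
  | m + 1, [s], _, _, hl, _ => by simp at hl; omega
  | m + 1, s :: t :: l, hc, hm, hl, hh => by
    have hs : s = a := (hm s (by simp)).resolve_right (by simpa using hh)
    rw [List.isChain_cons_cons] at hc
    have ht : t = b := (hm t (by simp)).resolve_left (hs ▸ hc.1.symm)
    have := eq_flatten_replicate_of_isChain_ne m l hc.2.tail (fun s h => hm s (by simp [h]))
      (by simp at hl; omega) (fun h => (List.isChain_cons.1 hc.2).1 b h ht)
    rw [List.replicate_succ, List.flatten_cons, ← this, hs, ht]
    rfl

end Syllables

/-! ### One-parameter subgroups and traces in `SL₂(ℂ)` -/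

/-- The hyperbolic one-parameter subgroup `z ↦ diag(exp z, exp (-z))`. -/
noncomputable def diagHom : Multiplicative ℂ →* SpecialLinearGroup (Fin 2) ℂ where
  toFun z := ⟨!![Complex.exp z.toAdd, 0; 0, Complex.exp (-z.toAdd)], by
    simp [det_fin_two, ← Complex.exp_add]⟩
  map_one' := by ext i j; fin_cases i <;> fin_cases j <;> simp
  map_mul' x y := by
    refine Subtype.ext ?_
    change _ = !![Complex.exp x.toAdd, 0; 0, Complex.exp (-x.toAdd)] *
      !![Complex.exp y.toAdd, 0; 0, Complex.exp (-y.toAdd)]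
    ext i j
    fin_cases i <;> fin_cases j <;> simp [Complex.exp_add, mul_comm]

/-- The lower unipotent one-parameter subgroup. -/
def lowerHom : Multiplicative ℂ →* SpecialLinearGroup (Fin 2) ℂ where
  toFun z := ⟨!![1, 0; z.toAdd, 1], by simp [det_fin_two]⟩
  map_one' := by ext i j; fin_cases i <;> fin_cases j <;> simp
  map_mul' x y := by
    refine Subtype.ext ?_
    change _ = !![1, 0; x.toAdd, 1] *
      !![1, 0; y.toAdd, 1]
    ext i j
    fin_cases i <;> fin_cases j <;> simp

/-- The upper unipotent one-parameter subgroup. -/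
def upperHom : Multiplicative ℂ →* SpecialLinearGroup (Fin 2) ℂ where
  toFun z := ⟨!![1, z.toAdd; 0, 1], by simp [det_fin_two]⟩
  map_one' := by ext i j; fin_cases i <;> fin_cases j <;> simp
  map_mul' x y := by
    refine Subtype.ext ?_
    change _ = !![1, x.toAdd; 0, 1] *
      !![1, y.toAdd; 0, 1]
    ext i j
    fin_cases i <;> fin_cases j <;> simp [add_comm]

lemma hom_ofAdd_zpow {G : Type*} [Group G] (f : Multiplicative ℂ →* G) (z : ℂ) (n : ℤ) :
    f (.ofAdd z) ^ n = f (.ofAdd (n * z)) := by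
  rw [← map_zpow, ← ofAdd_zsmul, zsmul_eq_mul]

section Character

variable {Γ : Type*} [Group Γ]

lemma character_eq_of_isConj {g h : Γ} (H : IsConj g h)
    (ρ : Γ →* SpecialLinearGroup (Fin 2) ℂ) : character g ρ = character h ρ := by
  obtain ⟨c, rfl⟩ := isConj_iff.1 H
  rw [character, character, map_mul, Matrix.SpecialLinearGroup.coe_mul, trace_mul_comm,
    ← Matrix.SpecialLinearGroup.coe_mul, ← map_mul]
  simp [← mul_assoc]

lemma character_inv (g : Γ) (ρ : Γ →* SpecialLinearGroup (Fin 2) ℂ) :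
    character g⁻¹ ρ = character g ρ := by
  simp [character, adjugate_fin_two, trace_fin_two, add_comm]

end Character

/-- The trace of a product of rank-one matrices `u vᵀ` is the product of the pairings `v · u` over
the cyclically adjacent factors, so it lies in any submonoid that contains all these pairings. -/
theorem trace_prod_vecMulVec_mem {α : Type*} (T : Submonoid ℂ) (u v : α → Fin 2 → ℂ)
    (p : α) (l : List α)
    (h : Cycle.Chain (fun p q => v p ⬝ᵥ u q ∈ T) ((p :: l : List α) : Cycle α)) :
    trace (((p :: l).map fun q => vecMulVec (u q) (v q)).prod) ∈ T := by
  have key : ∀ (l : List α) (p q : α), (p :: (l ++ [q])).IsChain (fun p q => v p ⬝ᵥ u q ∈ T) →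
      v p ⬝ᵥ ((l.map fun q => vecMulVec (u q) (v q)).prod *ᵥ u q) ∈ T := by
    intro l
    induction l with
    | nil => intro p q h; simpa using h
    | cons r l ih =>
      intro p q h
      rw [List.cons_append, List.isChain_cons_cons] at h
      rw [List.map_cons, List.prod_cons, ← mulVec_mulVec, vecMulVec_mulVec, dotProduct_smul]
      exact T.mul_mem h.1 (ih r q h.2)
  rw [Cycle.chain_coe_cons] at h
  rw [List.map_cons, List.prod_cons, vecMulVec_mul, trace_vecMulVec, dotProduct_comm,
    ← dotProduct_mulVec]
  exact key l p p h

/-! ### Asymptotics of characters -/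

/-- If two functions have equal squares and are asymptotic to `A exp (D τ)` and `A' exp (D' τ)`
with `A, A' ≠ 0`, then `D = D'` and `A ^ 2 = A' ^ 2`. -/
theorem eq_and_sq_eq_of_tendsto {f g : ℝ → ℂ} (hfg : ∀ τ, f τ ^ 2 = g τ ^ 2) {D D' : ℝ}
    {A A' : ℂ} (hA : A ≠ 0) (hA' : A' ≠ 0)
    (hf : Tendsto (fun τ : ℝ => (Real.exp (-(D * τ)) : ℂ) * f τ) atTop (𝓝 A))
    (hg : Tendsto (fun τ : ℝ => (Real.exp (-(D' * τ)) : ℂ) * g τ) atTop (𝓝 A')) :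
    D = D' ∧ A ^ 2 = A' ^ 2 := by
  have decay : ∀ {f g : ℝ → ℂ} (_ : ∀ τ, f τ ^ 2 = g τ ^ 2) {D D' : ℝ} {A A' : ℂ} (_ : A' ≠ 0)
    (_ : Tendsto (fun τ : ℝ => (Real.exp (-(D * τ)) : ℂ) * f τ) atTop (𝓝 A))
    (_ : Tendsto (fun τ : ℝ => (Real.exp (-(D' * τ)) : ℂ) * g τ) atTop (𝓝 A')), D' ≤ D := by
    intro f g hfg D D' A A' hA' hf hg
    by_contra! hlt
    have h0 : Tendsto (fun τ : ℝ => ((Real.exp (-((D' - D) * τ)) : ℝ) : ℂ)) atTop (𝓝 0) := by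
      have : Tendsto (fun τ : ℝ => Real.exp (-((D' - D) * τ))) atTop (𝓝 0) :=
        Real.tendsto_exp_neg_atTop_nhds_zero.comp (tendsto_id.const_mul_atTop (sub_pos.2 hlt))
      exact_mod_cast (Complex.continuous_ofReal.tendsto 0).comp this
    have h1 := (h0.mul hf).pow 2
    have h2 := hg.pow 2
    have : A' ^ 2 = (0 * A) ^ 2 := by
      refine tendsto_nhds_unique h2 (h1.congr fun τ => ?_)
      rw [← mul_assoc, ← Complex.ofReal_mul, ← Real.exp_add, mul_pow, mul_pow, hfg]
      congr 4
      ring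
    simp_all
  obtain rfl : D = D' := le_antisymm (decay (fun τ => (hfg τ).symm) hA hg hf) (decay hfg hA' hf hg)
  refine ⟨rfl, tendsto_nhds_unique (hf.pow 2) ((hg.pow 2).congr fun τ => ?_)⟩
  rw [mul_pow, mul_pow, hfg]

section Growth

variable {ι F : Type*} [Group F]

/-- If the image of each syllable `p` grows like `exp (d p * τ)` times a rank-one matrix, then the
character of the product grows with the sum of the exponents `d p`. -/
theorem tendsto_character_syllableProd (B : FreeGroupBasis ι F) (L : List (ι × ℤ))
    (ρ : ℝ → F →* SpecialLinearGroup (Fin 2) ℂ) (d : ι × ℤ → ℝ)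
    (M : ι × ℤ → Matrix (Fin 2) (Fin 2) ℂ)
    (h : ∀ p ∈ L, Tendsto (fun τ : ℝ => (Real.exp (-(d p * τ)) : ℂ) •
      (ρ τ (B p.1 ^ p.2) : Matrix (Fin 2) (Fin 2) ℂ)) atTop (𝓝 (M p))) :
    Tendsto (fun τ : ℝ => (Real.exp (-((L.map d).sum * τ)) : ℂ) *
      character (syllableProd B L) (ρ τ)) atTop (𝓝 (trace (L.map M).prod)) := by
  have h1 := tendsto_list_prod (f := fun (p : ι × ℤ) (τ : ℝ) => (Real.exp (-(d p * τ)) : ℂ) •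
      (ρ τ (B p.1 ^ p.2) : Matrix (Fin 2) (Fin 2) ℂ)) L h
  have h2 := ((continuous_id.matrix_trace (n := Fin 2) (R := ℂ)).tendsto _).comp h1
  refine h2.congr fun τ => ?_
  have h3 : (L.map fun p : ι × ℤ => (Real.exp (-(d p * τ)) : ℂ) •
      (ρ τ (B p.1 ^ p.2) : Matrix (Fin 2) (Fin 2) ℂ)).prod =
      (Real.exp (-((L.map d).sum * τ)) : ℂ) • (ρ τ (syllableProd B L)).1 := by
    clear h h1 h2
    induction L with
    | nil => simp
    | cons p L ih =>
      rw [List.map_cons, List.prod_cons, ih, smul_mul_smul_comm, List.map_cons, List.sum_cons,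
        syllableProd_cons, map_mul, Matrix.SpecialLinearGroup.coe_mul, ← Complex.ofReal_mul,
        ← Real.exp_add]
      congr 4
      ring
  simp only [Function.comp_apply, id, h3, trace_smul, smul_eq_mul, character]

end Growth

/-! ### Hyperbolic families: weighted letter counts -/

section Hyperbolic

variable {ι F : Type*} [Group F]

/-- Spellings by nonzero syllables in which cyclically adjacent syllables of the same generator have
exponents of the same sign. Both cyclically reduced lists of letters and cyclically alternating
lists of syllables are of this kind. -/
def IsCyclicallyNoncancelling (L : List (ι × ℤ)) : Prop :=
  (∀ p ∈ L, p.2 ≠ 0) ∧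
    Cycle.Chain (fun p q : ι × ℤ => p.1 = q.1 → 0 < p.2 * q.2) (L : Cycle (ι × ℤ))

/-- An element of `SL₂(ℂ)` that carries `∞` and `0` to `2 N + 1` and `2 N`. -/
def framing (N : ℕ) : SpecialLinearGroup (Fin 2) ℂ :=
  ⟨!![2 * N + 1, 2 * N; 1, 1], by simp [det_fin_two]⟩

/-- The representation at time `τ` sending the generator `s` to the hyperbolic element with
eigenvalues `exp (± K s * τ)`, attracting fixed point `2 φ(s) + 1` and repelling fixed point
`2 φ(s)`. -/
noncomputable def hyperbolicRep (B : FreeGroupBasis ι F) (φ : ι → ℕ) (K : ι → ℝ) (τ : ℝ) :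
    F →* SpecialLinearGroup (Fin 2) ℂ :=
  B.lift fun s => framing (φ s) * diagHom (.ofAdd ((K s * τ : ℝ) : ℂ)) * (framing (φ s))⁻¹

/-- The attracting fixed point of the image of a syllable. -/
def attracting (φ : ι → ℕ) (p : ι × ℤ) : ℤ := 2 * φ p.1 + if 0 < p.2 then 1 else 0

/-- The repelling fixed point of the image of a syllable. -/
def repelling (φ : ι → ℕ) (p : ι × ℤ) : ℤ := 2 * φ p.1 + if 0 < p.2 then 0 else 1

lemma hyperbolicRep_zpow (B : FreeGroupBasis ι F) (φ : ι → ℕ) (K : ι → ℝ) (τ : ℝ) (s : ι) (e : ℤ) :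
    (hyperbolicRep B φ K τ (B s ^ e)).1 =
      Complex.exp (((K s * e : ℝ) : ℂ) * τ) • vecMulVec ![2 * (φ s : ℂ) + 1, 1] ![1, -(2 * φ s)] +
      Complex.exp (-(((K s * e : ℝ) : ℂ) * τ)) •
        vecMulVec ![2 * (φ s : ℂ), 1] ![-1, 2 * φ s + 1] := by
  have h : hyperbolicRep B φ K τ (B s ^ e) =
      framing (φ s) * diagHom (.ofAdd (((K s * e : ℝ) : ℂ) * τ)) * (framing (φ s))⁻¹ := by
    rw [map_zpow, hyperbolicRep, lift_basis_apply, conj_zpow, hom_ofAdd_zpow]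
    congr 4
    push_cast
    ring
  rw [h, Matrix.SpecialLinearGroup.coe_mul, Matrix.SpecialLinearGroup.coe_mul,
    Matrix.SpecialLinearGroup.coe_inv]
  change !![2 * (φ s : ℂ) + 1, 2 * φ s; 1, 1] *
    !![Complex.exp (((K s * e : ℝ) : ℂ) * τ), 0; 0, Complex.exp (-(((K s * e : ℝ) : ℂ) * τ))] *
    adjugate !![2 * (φ s : ℂ) + 1, 2 * φ s; 1, 1] = _
  generalize Complex.exp (((K s * e : ℝ) : ℂ) * τ) = x
  generalize Complex.exp (-(((K s * e : ℝ) : ℂ) * τ)) = y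
  ext i j
  fin_cases i <;> fin_cases j <;> simp [adjugate_fin_two] <;> ring

lemma tendsto_exp_smul_add {c : ℝ} (hc : 0 < c) (X Y : Matrix (Fin 2) (Fin 2) ℂ) :
    Tendsto (fun τ : ℝ => (Real.exp (-(c * τ)) : ℂ) •
      (Complex.exp (c * τ) • X + Complex.exp (-(c * τ)) • Y)) atTop (𝓝 X) := by
  have h0 : Tendsto (fun τ : ℝ => ((Real.exp (-(2 * c * τ)) : ℝ) : ℂ)) atTop (𝓝 0) := by
    have : Tendsto (fun τ : ℝ => Real.exp (-(2 * c * τ))) atTop (𝓝 0) :=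
      Real.tendsto_exp_neg_atTop_nhds_zero.comp (tendsto_id.const_mul_atTop (by positivity))
    exact_mod_cast (Complex.continuous_ofReal.tendsto 0).comp this
  have h1 : Tendsto (fun τ : ℝ => X + ((Real.exp (-(2 * c * τ)) : ℝ) : ℂ) • Y) atTop (𝓝 X) := by
    simpa using tendsto_const_nhds.add (h0.smul_const Y)
  refine h1.congr fun τ => ?_
  rw [smul_add, smul_smul, smul_smul, Complex.ofReal_exp, Complex.ofReal_exp, ← Complex.exp_add,
    ← Complex.exp_add]
  push_cast
  rw [neg_add_cancel, Complex.exp_zero, one_smul]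
  congr 3
  ring

/-- After rescaling, the image of a syllable converges to the projection onto its attracting line
along its repelling line. -/
lemma tendsto_hyperbolicRep (B : FreeGroupBasis ι F) (φ : ι → ℕ) {K : ι → ℝ}
    (hK : ∀ s, 0 < K s) (p : ι × ℤ) (hp : p.2 ≠ 0) :
    Tendsto (fun τ : ℝ => (Real.exp (-(K p.1 * |(p.2 : ℝ)| * τ)) : ℂ) •
      (hyperbolicRep B φ K τ (B p.1 ^ p.2)).1) atTop
      (𝓝 (vecMulVec ![(attracting φ p : ℂ), 1]
        (((attracting φ p : ℂ) - repelling φ p) • ![1, -(repelling φ p : ℂ)]))) := by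
  simp_rw [hyperbolicRep_zpow]
  rcases hp.lt_or_gt with h | h
  · have hneg : (p.2 : ℝ) < 0 := by exact_mod_cast h
    have := tendsto_exp_smul_add (c := K p.1 * |(p.2 : ℝ)|)
      (mul_pos (hK _) (abs_pos.2 hneg.ne)) (vecMulVec ![2 * (φ p.1 : ℂ), 1] ![-1, 2 * φ p.1 + 1])
      (vecMulVec ![2 * (φ p.1 : ℂ) + 1, 1] ![1, -(2 * φ p.1)])
    convert this using 2 with τ
    · rw [abs_of_neg hneg, add_comm]
      push_cast
      simp
    · simp [attracting, repelling, h.le.not_gt]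
  · have hpos : (0 : ℝ) < p.2 := by exact_mod_cast h
    have := tendsto_exp_smul_add (c := K p.1 * |(p.2 : ℝ)|)
      (mul_pos (hK _) (abs_pos.2 hpos.ne')) (vecMulVec ![2 * (φ p.1 : ℂ) + 1, 1] ![1, -(2 * φ p.1)])
      (vecMulVec ![2 * (φ p.1 : ℂ), 1] ![-1, 2 * φ p.1 + 1])
    convert this using 2 with τ
    · rw [abs_of_pos hpos]
    · simp [attracting, repelling, h]

/-- For a noncancelling list the character along the hyperbolic representations has exact
exponential growth rate `∑ K s * |e|`: no attracting point is the repelling point of the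
preceding syllable, so the limiting product of projections has nonzero trace. -/
theorem exists_tendsto_character_hyperbolicRep (B : FreeGroupBasis ι F) (φ : ι → ℕ) {K : ι → ℝ}
    (hK : ∀ s, 0 < K s) {L : List (ι × ℤ)} (hL : IsCyclicallyNoncancelling L)
    (hφ : ∀ p ∈ L, ∀ q ∈ L, φ p.1 = φ q.1 → p.1 = q.1) :
    ∃ A : ℂ, A ≠ 0 ∧ Tendsto (fun τ : ℝ =>
      (Real.exp (-((L.map fun p => K p.1 * |(p.2 : ℝ)|).sum * τ)) : ℂ) *
        character (syllableProd B L) (hyperbolicRep B φ K τ)) atTop (𝓝 A) := by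
  refine ⟨_, ?_, tendsto_character_syllableProd B L (hyperbolicRep B φ K)
    (fun p => K p.1 * |(p.2 : ℝ)|) _ fun p hp => tendsto_hyperbolicRep B φ hK p (hL.1 p hp)⟩
  rcases L with _ | ⟨p, l⟩
  · simp
  · refine nonZeroDivisors.ne_zero (trace_prod_vecMulVec_mem (nonZeroDivisors ℂ) _ _ p l ?_)
    have hc := hL.2
    rw [Cycle.chain_coe_cons] at hc ⊢
    refine hc.imp_of_mem_imp fun q r hq hr hqr => mem_nonZeroDivisors_of_ne_zero ?_
    have hq : q ∈ p :: l := by simpa [or_comm, or_assoc] using hq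
    have hr : r ∈ p :: l := by simpa [or_comm, or_assoc] using hr
    have h0 := hL.1 q hq
    have h1 := hL.1 r hr
    have h2 : attracting φ q - repelling φ q ≠ 0 := by
      unfold attracting repelling; split_ifs <;> omega
    have h3 : attracting φ r - repelling φ q ≠ 0 := by
      intro h
      have h4 : φ q.1 = φ r.1 := by
        unfold attracting repelling at h; split_ifs at h <;> omega
      have h5 := hqr (hφ q hq r hr h4)
      rw [attracting, repelling, h4] at h
      rcases pos_and_pos_or_neg_and_neg_of_mul_pos h5 with h6 | h6
      · simp [h6.1, h6.2] at h
      · simp [h6.1.le.not_gt, h6.2.le.not_gt] at h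
    have h6 : ((attracting φ q : ℂ) - repelling φ q) * (attracting φ r - repelling φ q) ≠ 0 := by
      exact_mod_cast mul_ne_zero h2 h3
    rw [smul_dotProduct]
    simpa [sub_eq_add_neg] using h6

/-- The squared character of a noncancelling word determines every positively weighted count of its
letters. -/
theorem sum_mul_abs_eq_of_character_sq_eq (B : FreeGroupBasis ι F) {L L' : List (ι × ℤ)}
    (hL : IsCyclicallyNoncancelling L) (hL' : IsCyclicallyNoncancelling L')
    (h : ∀ ρ : F →* SpecialLinearGroup (Fin 2) ℂ,
      character (syllableProd B L) ρ ^ 2 = character (syllableProd B L') ρ ^ 2)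
    {K : ι → ℝ} (hK : ∀ s, 0 < K s) :
    (L.map fun p => K p.1 * |(p.2 : ℝ)|).sum = (L'.map fun p => K p.1 * |(p.2 : ℝ)|).sum := by
  classical
  have hφ : ∀ p ∈ L ++ L', ∀ q : ι × ℤ, ((L ++ L').map Prod.fst).idxOf p.1 =
      ((L ++ L').map Prod.fst).idxOf q.1 → p.1 = q.1 :=
    fun p hp q hpq => (List.idxOf_inj (List.mem_map_of_mem hp)).1 hpq
  obtain ⟨A, hA, h1⟩ := exists_tendsto_character_hyperbolicRep B
    (fun s => ((L ++ L').map Prod.fst).idxOf s) hK hL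
    fun p hp q _ => hφ p (List.mem_append_left _ hp) q
  obtain ⟨A', hA', h2⟩ := exists_tendsto_character_hyperbolicRep B
    (fun s => ((L ++ L').map Prod.fst).idxOf s) hK hL'
    fun p hp q _ => hφ p (List.mem_append_right _ hp) q
  exact (eq_and_sq_eq_of_tendsto (fun τ => h _) hA hA' h1 h2).1

/-- The squared character of a noncancelling word determines the set of its generators. -/
theorem fst_mem_of_character_sq_eq (B : FreeGroupBasis ι F) {L L' : List (ι × ℤ)}
    (hL : IsCyclicallyNoncancelling L) (hL' : IsCyclicallyNoncancelling L')
    (h : ∀ ρ : F →* SpecialLinearGroup (Fin 2) ℂ,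
      character (syllableProd B L) ρ ^ 2 = character (syllableProd B L') ρ ^ 2) :
    ∀ p ∈ L, p.1 ∈ L'.map Prod.fst := by
  classical
  intro p hp
  by_contra hp'
  -- doubling the weight of `p.1` alone changes the count for `L` but not the one for `L'`
  have h1 := sum_mul_abs_eq_of_character_sq_eq B hL hL' h (K := fun _ => 1) (fun _ => one_pos)
  have h2 := sum_mul_abs_eq_of_character_sq_eq B hL hL' h
    (K := fun s => if s = p.1 then 2 else 1) (fun s => by split_ifs <;> norm_num)
  have h3 : (L'.map fun q => (if q.1 = p.1 then 2 else 1 : ℝ) * |(q.2 : ℝ)|) =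
      L'.map fun q => 1 * |(q.2 : ℝ)| := by
    refine List.map_congr_left fun q hq => ?_
    rw [if_neg fun (h : q.1 = p.1) => hp' (h ▸ List.mem_map_of_mem hq)]
  rw [h3, ← h1] at h2
  refine (List.sum_lt_sum (l := L) _ _ (fun q _ => ?_) ⟨p, hp, ?_⟩).ne' h2
  · have := abs_nonneg (q.2 : ℝ)
    split_ifs <;> linarith
  · have : 0 < |(p.2 : ℝ)| := abs_pos.2 (by exact_mod_cast hL.1 p hp)
    rw [if_pos rfl]
    linarith

end Hyperbolic

/-! ### Unipotent families: syllable number and product of exponents -/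

section Unipotent

variable {ι F : Type*} [Group F]

/-- The representation sending `a` and `b` to the lower and upper unipotent matrices with
off-diagonal entry `exp τ`, and the other generators to `1`. -/
noncomputable def unipotentRep [DecidableEq ι] (B : FreeGroupBasis ι F) (a b : ι) (τ : ℝ) :
    F →* SpecialLinearGroup (Fin 2) ℂ :=
  B.lift fun s => if s = a then lowerHom (.ofAdd (Real.exp τ : ℂ)) else
    if s = b then upperHom (.ofAdd (Real.exp τ : ℂ)) else 1

/-- For a cyclically alternating word in two generators, the character along the unipotent
representations grows like `exp τ` to the number of syllables, with leading coefficient the product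
of the exponents. -/
theorem tendsto_character_unipotentRep [DecidableEq ι] (B : FreeGroupBasis ι F) {a b : ι}
    (hab : a ≠ b) {L : List (ι × ℤ)} (hne : L ≠ [])
    (hL : Cycle.Chain (fun p q : ι × ℤ => p.1 ≠ q.1) (L : Cycle (ι × ℤ)))
    (hmem : ∀ p ∈ L, p.1 = a ∨ p.1 = b) :
    Tendsto (fun τ : ℝ => (Real.exp (-((L.length : ℝ) * τ)) : ℂ) *
      character (syllableProd B L) (unipotentRep B a b τ)) atTop
      (𝓝 (((L.map Prod.snd).prod : ℤ) : ℂ)) := by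
  set u : ι × ℤ → Fin 2 → ℂ := fun p => if p.1 = a then ![0, 1] else ![1, 0] with hu
  set v : ι × ℤ → Fin 2 → ℂ := fun p => if p.1 = a then ![1, 0] else ![0, 1] with hv
  have h0 : Tendsto (fun τ : ℝ => (Real.exp (-(1 * τ)) : ℂ)) atTop (𝓝 0) := by
    have : Tendsto (fun τ : ℝ => Real.exp (-(1 * τ))) atTop (𝓝 0) := by
      simpa using Real.tendsto_exp_neg_atTop_nhds_zero
    exact_mod_cast (Complex.continuous_ofReal.tendsto 0).comp this
  have hexp : ∀ τ : ℝ, (Real.exp (-(1 * τ)) : ℂ) * (Real.exp τ : ℂ) = 1 := by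
    intro τ
    rw [← Complex.ofReal_mul, ← Real.exp_add]
    simp
  have h1 := tendsto_character_syllableProd B L (unipotentRep B a b) (fun _ => 1)
    (fun p => (p.2 : ℂ) • vecMulVec (u p) (v p)) fun p hp => by
      have h2 : ∀ τ : ℝ, (unipotentRep B a b τ (B p.1 ^ p.2)).1 =
          1 + ((p.2 : ℂ) * (Real.exp τ : ℂ)) • vecMulVec (u p) (v p) := by
        intro τ
        rw [map_zpow, unipotentRep, lift_basis_apply]
        rcases hmem p hp with h | h
        · rw [if_pos h, hom_ofAdd_zpow]
          change !![1, 0; (p.2 : ℂ) * (Real.exp τ : ℂ), 1] = _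
          ext i j
          fin_cases i <;> fin_cases j <;> simp [hu, hv, h]
        · rw [if_neg (h ▸ hab.symm), if_pos h, hom_ofAdd_zpow]
          change !![1, (p.2 : ℂ) * (Real.exp τ : ℂ); 0, 1] = _
          ext i j
          fin_cases i <;> fin_cases j <;> simp [hu, hv, h, hab.symm]
      have h3 : Tendsto (fun τ : ℝ => (Real.exp (-(1 * τ)) : ℂ) • (1 : Matrix (Fin 2) (Fin 2) ℂ) +
          (p.2 : ℂ) • vecMulVec (u p) (v p)) atTop (𝓝 ((p.2 : ℂ) • vecMulVec (u p) (v p))) := by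
        simpa using (h0.smul_const (1 : Matrix (Fin 2) (Fin 2) ℂ)).add_const
          ((p.2 : ℂ) • vecMulVec (u p) (v p))
      refine h3.congr fun τ => ?_
      rw [h2, smul_add, smul_smul, mul_left_comm, hexp, mul_one]
  have h4 : ∀ l : List (ι × ℤ), (l.map fun p => (p.2 : ℂ) • vecMulVec (u p) (v p)).prod =
      (((l.map Prod.snd).prod : ℤ) : ℂ) • (l.map fun p => vecMulVec (u p) (v p)).prod := by
    intro l
    induction l with
    | nil => simp
    | cons p l ih => simp [ih, smul_smul, mul_comm]
  have h5 : trace (L.map fun p => vecMulVec (u p) (v p)).prod = 1 := by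
    obtain ⟨p, l, rfl⟩ := List.exists_cons_of_ne_nil hne
    refine Submonoid.mem_bot.1 (trace_prod_vecMulVec_mem ⊥ u v p l ?_)
    rw [Cycle.chain_coe_cons] at hL ⊢
    refine hL.imp_of_mem_imp fun q r hq hr hqr => Submonoid.mem_bot.2 ?_
    have hq := hmem q (by simpa [or_comm, or_assoc] using hq)
    have hr := hmem r (by simpa [or_comm, or_assoc] using hr)
    rcases hq with hq | hq <;> rcases hr with hr | hr <;>
      simp_all [hab.symm]
  rw [h4, trace_smul, h5, smul_eq_mul, mul_one] at h1
  simpa using h1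

end Unipotent

/-! ### Diagonal representations: exponent sums -/

section Diagonal

variable {ι F : Type*} [Group F]

lemma character_diagonal (B : FreeGroupBasis ι F) (K : ι → ℝ) (L : List (ι × ℤ)) :
    character (syllableProd B L) (B.lift fun s => diagHom (.ofAdd (K s : ℂ))) =
      ((2 * Real.cosh (L.map fun p => K p.1 * p.2).sum : ℝ) : ℂ) := by
  have h : B.lift (fun s => diagHom (.ofAdd (K s : ℂ))) (syllableProd B L) =
      diagHom (.ofAdd (((L.map fun p => K p.1 * p.2).sum : ℝ) : ℂ)) := by
    induction L with
    | nil => simp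
    | cons p L ih =>
      rw [syllableProd_cons, map_mul, ih, map_zpow, lift_basis_apply,
        hom_ofAdd_zpow, ← map_mul, ← ofAdd_add]
      simp [mul_comm]
  rw [character, h]
  change trace !![_, _; _, _] = _
  rw [trace_fin_two, Complex.ofReal_mul, Complex.ofReal_cosh, Complex.cosh]
  simp [mul_div_cancel₀]

/-- Up to a common sign, the squared character determines the exponent sums. -/
theorem abs_sum_eq_of_character_sq_eq (B : FreeGroupBasis ι F) {L L' : List (ι × ℤ)}
    (h : ∀ ρ : F →* SpecialLinearGroup (Fin 2) ℂ,
      character (syllableProd B L) ρ ^ 2 = character (syllableProd B L') ρ ^ 2) (K : ι → ℝ) :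
    |(L.map fun p => K p.1 * p.2).sum| = |(L'.map fun p => K p.1 * p.2).sum| := by
  have h1 := h (B.lift fun s => diagHom (.ofAdd (K s : ℂ)))
  rw [character_diagonal, character_diagonal] at h1
  have h2 : Real.cosh (L.map fun p => K p.1 * p.2).sum =
      Real.cosh (L'.map fun p => K p.1 * p.2).sum := by
    have h3 : (2 * Real.cosh (L.map fun p => K p.1 * p.2).sum) ^ 2 =
      (2 * Real.cosh (L'.map fun p => K p.1 * p.2).sum) ^ 2 := by exact_mod_cast h1
    have h4 := (pow_left_inj₀ (by positivity) (by positivity) two_ne_zero).1 h3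
    linarith
  exact le_antisymm (Real.cosh_le_cosh.1 h2.le) (Real.cosh_le_cosh.1 h2.ge)

end Diagonal

/-! ### The equality case of the arithmetic-geometric mean inequality -/

lemma List.forall_eq_zero_of_sum_nonpos {l : List ℝ} (h : ∀ x ∈ l, 0 ≤ x) (hs : l.sum ≤ 0) :
    ∀ x ∈ l, x = 0 := fun x hx =>
  le_antisymm ((List.single_le_sum h x hx).trans hs) (h x hx)

/-- Summing `log x ≤ x - 1` gives an equality, so it is an equality for each member. -/
lemma List.forall_eq_one_of_sum_eq_length {l : List ℝ} (hpos : ∀ x ∈ l, 0 < x)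
    (hprod : l.prod = 1) (hsum : l.sum = l.length) : ∀ x ∈ l, x = 1 := by
  intro x hx
  have h1 : (l.map fun x => x - 1 - Real.log x).sum = 0 := by
    have : ∀ l : List ℝ, (∀ x ∈ l, 0 < x) →
        (l.map fun x => x - 1 - Real.log x).sum = l.sum - l.length - Real.log l.prod := by
      intro l
      induction l with
      | nil => simp
      | cons y l ih =>
        intro hl
        have hl' : ∀ x ∈ l, 0 < x := fun x hx => hl x (by simp [hx])
        rw [List.map_cons, List.sum_cons, ih hl', List.sum_cons, List.prod_cons, List.length_cons,
          Real.log_mul (hl y (by simp)).ne' (List.prod_pos hl').ne']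
        push_cast
        ring
    rw [this l hpos, hprod, hsum]
    simp
  have h2 := List.forall_eq_zero_of_sum_nonpos (l := l.map fun x => x - 1 - Real.log x)
    (by
      intro y hy
      obtain ⟨z, hz, rfl⟩ := List.mem_map.1 hy
      linarith [Real.log_le_sub_one_of_pos (hpos z hz)]) h1.le _ (List.mem_map_of_mem hx)
  by_contra hne
  linarith [Real.log_lt_sub_one_of_pos (hpos x hx) hne]

/-- If `n` real numbers have product `± 1` and sum `± n`, and their absolute values have sum `n`,
then they are all equal to `1` or all equal to `-1`. -/
lemma List.exists_sign_of_abs_sum_eq_length {l : List ℝ} (h0 : ∀ x ∈ l, x ≠ 0)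
    (hprod : |l.prod| = 1) (habs : (l.map fun x => |x|).sum = l.length)
    (hsum : |l.sum| = l.length) : ∃ ε : ℤ, (ε = 1 ∨ ε = -1) ∧ ∀ x ∈ l, x = ε := by
  have h1 : ∀ x ∈ l, |x| = 1 := by
    intro x hx
    refine List.forall_eq_one_of_sum_eq_length (l := l.map fun x => |x|) ?_ ?_ (by simpa using habs)
      |x| (List.mem_map_of_mem hx)
    · intro y hy
      obtain ⟨z, hz, rfl⟩ := List.mem_map.1 hy
      exact abs_pos.2 (h0 z hz)
    · rw [← hprod]
      exact (map_list_prod (absHom (α := ℝ)) l).symm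
  have key : ∀ ε : ℝ, (ε = 1 ∨ ε = -1) → ε * l.sum = l.length → ∀ x ∈ l, x = ε := by
    intro ε hε h x hx
    have h3 : (l.map fun x => 1 - ε * x).sum = 0 := by
      have : ∀ l : List ℝ, (l.map fun x => 1 - ε * x).sum = l.length - ε * l.sum := by
        intro l
        induction l with
        | nil => simp
        | cons y l ih =>
          rw [List.map_cons, List.sum_cons, ih, List.sum_cons, List.length_cons]
          push_cast
          ring
      rw [this, h, sub_self]
    have h4 := List.forall_eq_zero_of_sum_nonpos (l := l.map fun x => 1 - ε * x) (by
      intro y hy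
      obtain ⟨z, hz, rfl⟩ := List.mem_map.1 hy
      have := abs_le.1 (h1 z hz).le
      rcases hε with rfl | rfl <;> linarith) h3.le _ (List.mem_map_of_mem hx)
    rcases hε with rfl | rfl <;> linarith
  rcases abs_choice l.sum with h | h
  · exact ⟨1, .inl rfl, by simpa using key 1 (.inl rfl) (by rw [one_mul, ← h, hsum])⟩
  · exact ⟨-1, .inr rfl, by simpa using key (-1) (.inr rfl) (by rw [neg_one_mul, ← h, hsum])⟩

/-! ### Recovering a word from its squared character -/

section Recovery

variable {ι F : Type*} [Group F]

lemma IsCyclicallyNoncancelling.of_chain_ne {L : List (ι × ℤ)} (h0 : ∀ p ∈ L, p.2 ≠ 0)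
    (h : L.length ≠ 1 → Cycle.Chain (fun p q : ι × ℤ => p.1 ≠ q.1) (L : Cycle (ι × ℤ))) :
    IsCyclicallyNoncancelling L := by
  refine ⟨h0, ?_⟩
  by_cases h1 : L.length = 1
  · obtain ⟨p, rfl⟩ := List.length_eq_one_iff.1 h1
    exact (Cycle.chain_singleton _ _).2 fun _ => mul_self_pos.2 (h0 p (by simp))
  · exact (h h1).imp fun p q hpq h => absurd h hpq

/-- The squared character of a power of a basis element determines its conjugacy class up to
inversion. -/
theorem isConj_or_isConj_inv_of_basis_zpow (B : FreeGroupBasis ι F) (a : ι) (l : ℤ) {y : F}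
    (h : ∀ ρ : F →* SpecialLinearGroup (Fin 2) ℂ,
      character (B a ^ l) ρ ^ 2 = character y ρ ^ 2) :
    IsConj (B a ^ l) y ∨ IsConj (B a ^ l)⁻¹ y := by
  obtain ⟨L, hconj, h0, hc⟩ := exists_cyclicallyReduced_syllables B y
  have hL := IsCyclicallyNoncancelling.of_chain_ne h0 hc
  by_cases hl : l = 0
  · have h1 := fst_mem_of_character_sq_eq B hL (L' := []) ⟨by simp, Cycle.Chain.nil _⟩
      fun ρ => by simp [character_eq_of_isConj hconj, ← h, hl]
    obtain rfl : L = [] := List.eq_nil_iff_forall_not_mem.2 fun p hp => by simpa using h1 p hp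
    exact .inl (by simpa [hl] using hconj)
  have hL' : IsCyclicallyNoncancelling [(a, l)] :=
    .of_chain_ne (by simpa using hl) fun h => absurd rfl h
  have h1 : ∀ ρ : F →* SpecialLinearGroup (Fin 2) ℂ,
      character (syllableProd B L) ρ ^ 2 = character (syllableProd B [(a, l)]) ρ ^ 2 :=
    fun ρ => by simp [character_eq_of_isConj hconj, ← h]
  have h2 : ∀ p ∈ L, p.1 = a := by simpa using fst_mem_of_character_sq_eq B hL hL' h1
  have h3 := fst_mem_of_character_sq_eq B hL' hL fun ρ => (h1 ρ).symm
  rcases L with _ | ⟨p, _ | ⟨q, L⟩⟩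
  · simp at h3
  · obtain ⟨s, e⟩ := p
    obtain rfl : s = a := by simpa using h2
    have h4 := sum_mul_abs_eq_of_character_sq_eq B hL hL' h1 (K := fun _ => 1) fun _ => one_pos
    have h5 : |e| = |l| := by
      have : |(e : ℝ)| = |(l : ℝ)| := by simpa using h4
      exact_mod_cast this
    rcases abs_eq_abs.1 h5 with rfl | rfl
    · exact .inl (by simpa using hconj)
    · exact .inr (by simpa using hconj)
  · have h4 := hc (by simp)
    rw [Cycle.chain_coe_cons, List.cons_append, List.isChain_cons_cons] at h4
    exact absurd ((h2 p (by simp)).trans (h2 q (by simp)).symm) h4.1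

lemma syllableProd_flatten_replicate (B : FreeGroupBasis ι F) (p q : ι × ℤ) (M : ℕ) :
    syllableProd B (List.replicate M [p, q]).flatten = (B p.1 ^ p.2 * B q.1 ^ q.2) ^ M := by
  induction M with
  | zero => simp
  | succ M ih => simp [List.replicate_succ, ih, pow_succ', mul_assoc]

lemma cycleChain_flatten_replicate {p q : ι × ℤ} (h : p.1 ≠ q.1) (M : ℕ) :
    Cycle.Chain (fun p q : ι × ℤ => p.1 ≠ q.1)
      ((List.replicate M [p, q]).flatten : Cycle (ι × ℤ)) := by
  have key : ∀ M : ℕ, ((List.replicate M [p, q]).flatten ++ [p]).IsChain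
      (fun p q : ι × ℤ => p.1 ≠ q.1) ∧
      ((List.replicate M [p, q]).flatten ++ [p]).head? = some p := by
    intro M
    induction M with
    | zero => simp
    | succ M ih =>
      refine ⟨?_, by simp [List.replicate_succ]⟩
      rw [List.replicate_succ, List.flatten_cons]
      change (p :: q :: ((List.replicate M [p, q]).flatten ++ [p])).IsChain _
      refine List.isChain_cons_cons.2 ⟨h, ih.1.cons fun r hr => ?_⟩
      rw [ih.2] at hr
      obtain rfl : p = r := by simpa using hr
      exact h.symm
  cases M with
  | zero => exact Cycle.Chain.nil _
  | succ M =>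
    have := (key (M + 1)).1
    rw [List.replicate_succ, List.flatten_cons] at this ⊢
    exact (Cycle.chain_coe_cons _ _ _).2 this

/-- The squared character of a positive power of `a ^ j * b ^ k`, for distinct basis elements `a`
and `b` and nonzero `j` and `k`, determines its conjugacy class up to inversion. -/
theorem isConj_or_isConj_inv_of_basis_zpow_mul_zpow_pow (B : FreeGroupBasis ι F) {a b : ι}
    (hab : a ≠ b) {j k : ℤ} (hj : j ≠ 0) (hk : k ≠ 0) {M : ℕ} (hM : M ≠ 0) {y : F}
    (h : ∀ ρ : F →* SpecialLinearGroup (Fin 2) ℂ,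
      character ((B a ^ j * B b ^ k) ^ M) ρ ^ 2 = character y ρ ^ 2) :
    IsConj ((B a ^ j * B b ^ k) ^ M) y ∨ IsConj ((B a ^ j * B b ^ k) ^ M)⁻¹ y := by
  classical
  obtain ⟨L, hconj, h0, hc⟩ := exists_cyclicallyReduced_syllables B y
  have hL := IsCyclicallyNoncancelling.of_chain_ne h0 hc
  set L' := (List.replicate M [(a, j), (b, k)]).flatten with hL'def
  have hmem' : ∀ p : ι × ℤ, p ∈ L' ↔ p = (a, j) ∨ p = (b, k) := by
    simp [hL'def, List.mem_flatten, hM]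
  have hc' := cycleChain_flatten_replicate (p := (a, j)) (q := (b, k)) hab M
  have hL' : IsCyclicallyNoncancelling L' := .of_chain_ne (fun p hp => by
    rcases (hmem' p).1 hp with rfl | rfl
    exacts [hj, hk]) fun _ => hc'
  have h1 : ∀ ρ : F →* SpecialLinearGroup (Fin 2) ℂ,
      character (syllableProd B L) ρ ^ 2 = character (syllableProd B L') ρ ^ 2 := fun ρ => by
    rw [character_eq_of_isConj hconj, ← h, syllableProd_flatten_replicate]
  have hmem : ∀ p ∈ L, p.1 = a ∨ p.1 = b := by
    intro p hp
    obtain ⟨q, hq, hqp⟩ := List.mem_map.1 (fst_mem_of_character_sq_eq B hL hL' h1 p hp)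
    rw [← hqp]
    rcases (hmem' q).1 hq with rfl | rfl <;> simp
  have hmemL : ∀ p ∈ L', p.1 ∈ L.map Prod.fst :=
    fst_mem_of_character_sq_eq B hL' hL fun ρ => (h1 ρ).symm
  have ha := hmemL _ ((hmem' (a, j)).2 (.inl rfl))
  have hb := hmemL _ ((hmem' (b, k)).2 (.inr rfl))
  have hne : L ≠ [] := by
    rintro rfl
    simp at ha
  have hcL := hc fun hlen => by
    obtain ⟨p, rfl⟩ := List.length_eq_one_iff.1 hlen
    exact hab (by simp_all)
  -- the unipotent representations give the number of syllables and the product of the exponents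
  have hne' : L' ≠ [] := List.ne_nil_of_mem ((hmem' (a, j)).2 (.inl rfl))
  have hprodL : (L.map Prod.snd).prod ≠ 0 := List.prod_ne_zero fun h => by
    obtain ⟨p, hp, hp0⟩ := List.mem_map.1 h
    exact h0 p hp hp0
  have hprodL' : (L'.map Prod.snd).prod = (j * k) ^ M := by
    simp [hL'def, List.map_flatten, List.prod_flatten]
  obtain ⟨hlen, hprod⟩ := eq_and_sq_eq_of_tendsto (fun τ => h1 _)
    (by exact_mod_cast hprodL) (by rw [hprodL']; exact_mod_cast pow_ne_zero _ (mul_ne_zero hj hk))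
    (tendsto_character_unipotentRep B hab hne hcL hmem)
    (tendsto_character_unipotentRep B hab hne' hc' fun p hp => by
      rcases (hmem' p).1 hp with rfl | rfl <;> simp)
  have hlen : L.length = 2 * M := by
    have : L.length = L'.length := by exact_mod_cast hlen
    rw [this, hL'def]
    simp [mul_comm]
  have hprod : (L.map Prod.snd).prod ^ 2 = ((j * k) ^ M) ^ 2 := by
    rw [← hprodL']
    exact_mod_cast hprod
  have halt : L.map Prod.fst = (List.replicate M [a, b]).flatten ∨
      L.map Prod.fst = (List.replicate M [b, a]).flatten := by
    have hch : (L.map Prod.fst).IsChain (· ≠ ·) := by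
      obtain ⟨p, l, rfl⟩ := List.exists_cons_of_ne_nil hne
      rw [Cycle.chain_coe_cons, ← List.cons_append] at hcL
      exact (List.isChain_map _).2 hcL.left_of_append
    have hm : ∀ s ∈ L.map Prod.fst, s = a ∨ s = b := fun s hs => by
      obtain ⟨p, hp, rfl⟩ := List.mem_map.1 hs
      exact hmem p hp
    by_cases hh : (L.map Prod.fst).head? = some b
    · exact .inr (eq_flatten_replicate_of_isChain_ne M _ hch (fun s hs => (hm s hs).symm)
        (by simpa using hlen) (by rw [hh]; simpa using hab.symm))
    · exact .inl (eq_flatten_replicate_of_isChain_ne M _ hch hm (by simpa using hlen) hh)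
  -- compare each exponent with the one of the same generator in `a ^ j * b ^ k`
  set f : ι → ℤ := fun s => if s = a then j else k with hf
  have hfa : f a = j := by simp [hf]
  have hfb : f b = k := by simp [hf, hab.symm]
  have hf0 : ∀ s, f s ≠ 0 := fun s => by
    simp only [hf]
    split_ifs
    exacts [hj, hk]
  have hf0' : ∀ s, (f s : ℝ) ≠ 0 := fun s => by exact_mod_cast hf0 s
  have hfprod : ((L.map Prod.fst).map f).prod = (j * k) ^ M := by
    rcases halt with h | h <;> rw [h] <;>
      simp [List.map_flatten, List.prod_flatten, hfa, hfb, mul_comm]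
  obtain ⟨ε, hε, hxε⟩ := List.exists_sign_of_abs_sum_eq_length
    (l := L.map fun p => (f p.1 : ℝ)⁻¹ * p.2)
    (by
      intro x hx
      obtain ⟨p, hp, rfl⟩ := List.mem_map.1 hx
      exact mul_ne_zero (inv_ne_zero (hf0' _)) (by exact_mod_cast h0 p hp))
    (by
      have hmul : (((L.map Prod.fst).map f).prod : ℝ) * (L.map fun p => (f p.1 : ℝ)⁻¹ * p.2).prod =
          ((L.map Prod.snd).prod : ℤ) := by
        clear * - hf0'
        induction L with
        | nil => simp
        | cons p L ih =>
          simp only [List.map_cons, List.prod_cons, Int.cast_mul]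
          rw [← ih]
          field_simp [hf0' p.1]
      rw [hfprod] at hmul
      have h2 : (((j * k) ^ M : ℤ) : ℝ) ≠ 0 := by
        exact_mod_cast pow_ne_zero _ (mul_ne_zero hj hk)
      have h3 : (((L.map Prod.snd).prod : ℤ) : ℝ) ^ 2 = (((j * k) ^ M : ℤ) : ℝ) ^ 2 := by
        exact_mod_cast hprod
      have h4 := sq_eq_sq_iff_abs_eq_abs _ _ |>.1 h3
      rw [← hmul, abs_mul] at h4
      exact mul_left_cancel₀ (abs_ne_zero.2 h2) (by rw [h4, mul_one]))
    (by
      have := sum_mul_abs_eq_of_character_sq_eq B hL hL' h1 (K := fun s => |(f s : ℝ)|⁻¹)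
        fun s => inv_pos.2 (abs_pos.2 (hf0' s))
      rw [List.map_map, List.length_map, hlen]
      refine (congrArg List.sum (List.map_congr_left fun p _ => ?_)).trans (this.trans ?_)
      · simp [abs_mul, abs_inv]
      · have hj' : |(j : ℝ)| ≠ 0 := abs_ne_zero.2 (by exact_mod_cast hj)
        have hk' : |(k : ℝ)| ≠ 0 := abs_ne_zero.2 (by exact_mod_cast hk)
        simp [hL'def, List.map_flatten, List.sum_flatten, hfa, hfb, hj', hk']
        ring)
    (by
      rw [List.length_map, hlen,
        abs_sum_eq_of_character_sq_eq B h1 fun s => (f s : ℝ)⁻¹]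
      have hj' : (j : ℝ) ≠ 0 := by exact_mod_cast hj
      have hk' : (k : ℝ) ≠ 0 := by exact_mod_cast hk
      have : (L'.map fun p => (f p.1 : ℝ)⁻¹ * p.2).sum = ((2 * M : ℕ) : ℝ) := by
        simp [hL'def, List.map_flatten, List.sum_flatten, hfa, hfb, hj', hk']
        ring
      rw [this, Nat.abs_cast])
  have hLmap : L = (L.map Prod.fst).map fun s => (s, ε * f s) := by
    rw [List.map_map]
    conv_lhs => rw [← List.map_id L]
    refine List.map_congr_left fun p hp => Prod.ext rfl ?_
    have h2 := hxε _ (List.mem_map_of_mem hp)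
    have h3 : (p.2 : ℝ) = ε * f p.1 := by
      rw [← h2]
      field_simp [hf0' p.1]
    exact_mod_cast h3
  have hprodL : syllableProd B L = (B a ^ (ε * j) * B b ^ (ε * k)) ^ M ∨
      syllableProd B L = (B b ^ (ε * k) * B a ^ (ε * j)) ^ M := by
    rcases halt with h | h <;> rw [h] at hLmap
    · left
      rw [hLmap]
      simpa [List.map_flatten, hfa, hfb] using
        syllableProd_flatten_replicate B (a, ε * j) (b, ε * k) M
    · right
      rw [hLmap]
      simpa [List.map_flatten, hfa, hfb] using
        syllableProd_flatten_replicate B (b, ε * k) (a, ε * j) M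
  have hswap : IsConj ((B a ^ (ε * j) * B b ^ (ε * k)) ^ M)
      ((B b ^ (ε * k) * B a ^ (ε * j)) ^ M) := 
    (isConj_mul_comm _ _).pow M
  rcases hε with rfl | rfl
  · left
    simp only [one_mul] at hswap hprodL
    rcases hprodL with h | h <;> rw [h] at hconj
    exacts [hconj, hswap.trans hconj]
  · right
    have hinv : ((B a ^ j * B b ^ k) ^ M)⁻¹ = (B b ^ (-1 * k) * B a ^ (-1 * j)) ^ M := by
      simp [← inv_pow]
    rw [hinv]
    rcases hprodL with h | h <;> rw [h] at hconj
    exacts [hswap.symm.trans hconj, hconj]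

end Recovery

theorem mainTheorem8 {F : Type*} [Group F] [IsFreeGroup F] (a b : F)
    (hab : PrimitiveElements a b) (j k : ℤ) :
    ∀ x : F, ¬ TraceTwins (a ^ j * b ^ k) x := by
  rintro x ⟨⟨m, n, hm, hn, h⟩, hx⟩
  obtain ⟨S, B, hB, ha, hb⟩ := hab
  refine hx ?_
  suffices H : IsConj ((a ^ j * b ^ k) ^ m) (x ^ n) ∨ IsConj ((a ^ j * b ^ k) ^ m)⁻¹ (x ^ n) by
    rcases H with H | H
    · exact ⟨m, n, hm, hn, H⟩
    · exact ⟨-m, n, neg_ne_zero.2 hm, hn, by rwa [zpow_neg]⟩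
  obtain ⟨s, rfl⟩ : ∃ s, B s = a := ⟨⟨a, ha⟩, hB _⟩
  obtain ⟨t, rfl⟩ : ∃ t, B t = b := ⟨⟨b, hb⟩, hB _⟩
  -- the degenerate cases, in which the word is a power of one basis element
  have hpow : ∀ (r : S) (l : ℤ), B s ^ j * B t ^ k = B r ^ l →
      IsConj ((B s ^ j * B t ^ k) ^ m) (x ^ n) ∨
        IsConj ((B s ^ j * B t ^ k) ^ m)⁻¹ (x ^ n) := by
    intro r l hr
    rw [hr, ← zpow_mul] at h ⊢
    exact isConj_or_isConj_inv_of_basis_zpow B r (l * m) h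
  by_cases hj : j = 0
  · exact hpow t k (by simp [hj])
  by_cases hk : k = 0
  · exact hpow s j (by simp [hk])
  by_cases hst : s = t
  · exact hpow s (j + k) (by rw [hst, zpow_add])
  obtain ⟨M, hM⟩ := m.eq_nat_or_neg
  have hM0 : M ≠ 0 := by
    rintro rfl
    exact hm (by simpa using hM)
  have key : ∀ ρ : F →* SpecialLinearGroup (Fin 2) ℂ,
      character ((B s ^ j * B t ^ k) ^ M) ρ ^ 2 = character (x ^ n) ρ ^ 2 := by
    intro ρ
    rw [← h ρ]
    rcases hM with rfl | rfl
    · rw [zpow_natCast]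
    · rw [zpow_neg, zpow_natCast, character_inv]
  have := isConj_or_isConj_inv_of_basis_zpow_mul_zpow_pow B hst hj hk hM0 key
  rcases hM with rfl | rfl
  · rwa [zpow_natCast]
  · rw [zpow_neg, zpow_natCast, inv_inv]
    exact this.symm
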